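/- Let $N,D,C,r\ge 0$ be integers, $\varepsilon\ge 0$, $\sigma>0$, $p\in[0,1]$, $\mathcal Y=\{1,\dots,C\}$, and $\mathcal Z=\mathbb R^{N\times D}\times\{0,1\}^N$. For $X\in\mathbb R^{N\times D}$ with rows $x_i$ let $\Psi_X$ be the law on $\mathcal Z$ of the pair $(W,\tau)$ obtained as follows: the $\tau_i$ are i.i.d. $\mathrm{Ber}(p)$ and, given $\tau$, the rows $w_i$ of $W$ are independent with $w_i\sim\mathcal N(x_i,\sigma^2 I)$ if $\tau_i=1$ and $w_i=x_i$ if $\tau_i=0$. For a measurable base classifier $f:\mathcal Z\to\mathcal Y$ put $p_{X,y}=\Pr_{Z\sim\Psi_X}[f(Z)=y]$, and let $g:\mathbb R^{N\times D}\to\mathcal Y$ be the smoothed classifier, $g(X)\in\arg\max_{y\in\mathcal Y}p_{X,y}$ for every $X$ (ties broken arbitrarily). For matrices $X,\tilde X$ and a label $y$ let $$\underline{p_{\tilde X,y}}=\inf\bigl\{\Pr_{Z\sim\Psi_{\tilde X}}[h(Z)=y]\;:\;h:\mathcal Z\to\mathcal Y\text{ measurable},\ \Pr_{Z\sim\Psi_X}[h(Z)=y]=p_{X,y}\bigr\},$$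 and let $$\mathcal B_{2,\varepsilon}^r(X)=\Bigl\{\tilde X\in\mathbb R^{N\times D}:\ \#\{i:x_i\ne\tilde x_i\}\le r,\ \|\mathrm{vec}(X-\tilde X)\|_2\le\varepsilon\Bigr\}.$$ Let $\Phi$ be the standard normal distribution function and $\Phi^{-1}(q)=\inf\{x\in\mathbb R:\Phi(x)\ge q\}\in[-\infty,\infty]$ its inverse (so $\Phi^{-1}(q)=-\infty$ for $q\le 0$ and $\Phi^{-1}(q)=+\infty$ for $q\ge 1$). Fix $X\in\mathbb R^{N\times D}$ and put $y^*=g(X)$ and $\Delta=1-p^r$. If $$\varepsilon<\sigma\left(\Phi^{-1}\!\left(\frac{p_{X,y^*}-\Delta}{1-\Delta}\right)-\Phi^{-1}\!\left(\frac{1}{2(1-\Delta)}\right)\right)$$ (a condition that is regarded as violated when $\Delta\ge\tfrac12$), then $g$ is certifiably robust over the whole ball: $\inf_{\tilde X\in\mathcal B_{2,\varepsilon}^r(X)}\underline{p_{\tilde X,y^*}}>\tfrac12$, and in particular $g(\tilde X)=g(X)$ for every $\tilde X\in\mathcal B_{2,\varepsilon}^r(X)$. -/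

import Mathlib

open MeasureTheory ProbabilityTheory

noncomputable section

namespace HierarchicalSmoothing

/-- Data matrices with `N` rows (the entities) and `D` real columns. -/
abbrev Mat (N D : ℕ) : Type := Fin N → Fin D → ℝ

/-- The extended space: a matrix `W` together with an indicator column `τ` (one bit per row). -/
abbrev Ext (N D : ℕ) : Type := Mat N D × (Fin N → Bool)

/-- The threat model: at most `r` rows of `X` are changed, and the vectorized perturbation
has Euclidean norm at most `ε`. -/
def threatModel {N D : ℕ} (r : ℕ) (ε : ℝ) (X : Mat N D) : Set (Mat N D) :=
  {X' | {i | X i ≠ X' i}.ncard ≤ r ∧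
    ‖(WithLp.toLp 2 (fun ij : Fin N × Fin D => X ij.1 ij.2 - X' ij.1 ij.2) :
      EuclideanSpace ℝ (Fin N × Fin D))‖ ≤ ε}

/-- The upper-level distribution of the indicator: i.i.d. Bernoulli with success
probability `p`; `true` means that the row is selected. -/
def upper (N : ℕ) (p : unitInterval) : Measure (Fin N → Bool) :=
  Measure.pi fun _ => bernoulliMeasure true false p

/-- The conditional distribution of the noisy matrix given the indicator `τ`: the rows are
independent, a selected row has distribution `N(x_i, σ² I)`, an unselected row stays `x_i`. -/
def lower {N D : ℕ} (σ : ℝ) (X : Mat N D) (τ : Fin N → Bool) : Measure (Mat N D) :=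
  Measure.pi fun i =>
    if τ i = true then Measure.pi fun j => gaussianReal (X i j) (σ ^ 2).toNNReal
    else Measure.dirac (X i)

/-- The hierarchical smoothing distribution around `X`, the joint law of `(W, τ)`: first `τ` is
drawn from `upper`, then `W` given `τ` from `lower`. -/
def hier {N D : ℕ} (p : unitInterval) (σ : ℝ) (X : Mat N D) : Measure (Ext N D) :=
  ∑ τ : Fin N → Bool, upper N p {τ} • (lower σ X τ).map (fun W => (W, τ))

/-- The probability that the classifier `h` outputs the label `y` under the smoothing
distribution around `X`. -/
def labelProb {N D C : ℕ} (p : unitInterval) (σ : ℝ) (h : Ext N D → Fin C)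
    (X : Mat N D) (y : Fin C) : ℝ :=
  (hier p σ X).real {z | h z = y}

/-- `g` is a smoothed classifier of `f`: at every input it outputs a most likely label,
ties being broken in an arbitrary way. -/
def IsSmoothed {N D C : ℕ} (p : unitInterval) (σ : ℝ) (f : Ext N D → Fin C)
    (g : Mat N D → Fin C) : Prop :=
  ∀ X y, labelProb p σ f X y ≤ labelProb p σ f X (g X)

/-- The worst-case probability of the label `y` at the perturbed input `X'`, over all
classifiers whose probability of `y` at the clean input `X` is `q`. -/
def worstCase {N D : ℕ} (C : ℕ) (p : unitInterval) (σ : ℝ) (X X' : Mat N D)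
    (y : Fin C) (q : ℝ) : ℝ :=
  sInf {t | ∃ h : Ext N D → Fin C, Measurable h ∧ labelProb p σ h X y = q ∧
    labelProb p σ h X' y = t}

/-- The inverse of the standard normal distribution function, as an extended real: the inverse
on `(0, 1)`, equal to `⊥` for `q ≤ 0` and to `⊤` for `1 ≤ q`. -/
def quantile (q : ℝ) : EReal :=
  sInf ((fun x : ℝ => (x : EReal)) '' {x : ℝ | q ≤ cdf (gaussianReal 0 1) x})

end HierarchicalSmoothing

end

/-! Let `K` be the set of changed rows, so `K.card ≤ r`. With probability `p ^ K.card ≥ p ^ r` every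
row of `K` is selected. On this event the laws of `W` at the two inputs have a Gaussian likelihood
ratio that is monotone in one linear functional of `W` and does not involve `τ`. Neyman-Pearson
therefore gives, with one slope for all such `τ`, an affine lower bound for the conditional
probability at `X'` (`exists_lower_bound`), and an affine bound survives averaging over `τ`. The
other indicators account for at most `1 - p ^ r` of the mass at `X` and are discarded at `X'`; this
yields `hier_real_lower_bound`. Its bound depends on neither `X'` nor the classifier, so the infima
stay strictly above one half. -/

namespace HierarchicalSmoothing

/-! ### Product measures, Neyman-Pearson, one-dimensional Gaussians -/

/-- A product of measures with densities has the product density. -/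
lemma pi_withDensity {ι : Type*} [Fintype ι] {α : ι → Type*} [∀ i, MeasurableSpace (α i)]
    (μ : ∀ i, Measure (α i)) [∀ i, IsProbabilityMeasure (μ i)] (f : ∀ i, α i → ENNReal)
    (hf : ∀ i, Measurable (f i)) [∀ i, IsProbabilityMeasure ((μ i).withDensity (f i))] :
    Measure.pi (fun i => (μ i).withDensity (f i)) =
      (Measure.pi μ).withDensity (fun x => ∏ i, f i (x i)) := by
  refine Measure.pi_eq fun s hs => ?_
  rw [withDensity_apply _ (MeasurableSet.univ_pi hs), ← lintegral_indicator (MeasurableSet.univ_pi hs)]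
  have h1 : (Set.univ.pi s).indicator (fun x => ∏ i, f i (x i)) =
      fun x => ∏ i, (s i).indicator (f i) (x i) := by
    classical
    funext x
    by_cases hx : x ∈ Set.univ.pi s
    · rw [Set.indicator_of_mem hx]
      exact Finset.prod_congr rfl fun i _ =>
        (Set.indicator_of_mem (hx i (Set.mem_univ i)) (f i)).symm
    · rw [Set.indicator_of_notMem hx]
      simp only [Set.mem_pi, Set.mem_univ, true_implies, not_forall] at hx
      obtain ⟨i, hi⟩ := hx
      exact (Finset.prod_eq_zero (Finset.mem_univ i) (Set.indicator_of_notMem hi _)).symm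
  have hm : ∀ i, Measurable ((s i).indicator (f i)) := fun i => (hf i).indicator (hs i)
  rw [h1]
  refine (lintegral_prod_eq_prod_lintegral_of_indepFun Finset.univ
    (fun i (x : ∀ i, α i) => (s i).indicator (f i) (x i)) (iIndepFun_pi fun i => (hm i).aemeasurable)
    fun i => (hm i).comp (measurable_pi_apply i)).trans ?_
  refine Finset.prod_congr rfl fun i _ => ?_
  rw [withDensity_apply _ (hs i), ← lintegral_indicator (hs i),
    ← (measurePreserving_eval μ i).lintegral_comp (hm i)]

/-- The sum of independent Gaussian variables, realized on a product space, is Gaussian. -/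
lemma map_sum_pi_gaussianReal {ι : Type*} [Fintype ι] {α : ι → Type*}
    [∀ i, MeasurableSpace (α i)] (μ : ∀ i, Measure (α i)) [∀ i, IsProbabilityMeasure (μ i)]
    (f : ∀ i, α i → ℝ) (hf : ∀ i, Measurable (f i)) (m : ι → ℝ) (v : ι → NNReal)
    (h : ∀ i, (μ i).map (f i) = gaussianReal (m i) (v i)) :
    (Measure.pi μ).map (fun x => ∑ i, f i (x i)) = gaussianReal (∑ i, m i) (∑ i, v i) := by
  have hm : Measurable fun x : ∀ i, α i => ∑ i, f i (x i) :=
    Finset.measurable_sum _ fun i _ => (hf i).comp (measurable_pi_apply i)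
  have : IsProbabilityMeasure ((Measure.pi μ).map (fun x => ∑ i, f i (x i))) :=
    Measure.isProbabilityMeasure_map hm.aemeasurable
  refine Measure.ext_of_charFun (funext fun t => ?_)
  have hi : ∀ i, ∫ x, Complex.exp (t * f i x * Complex.I) ∂μ i =
      Complex.exp (t * m i * Complex.I - v i * t ^ 2 / 2) := fun i => by
    rw [← charFun_gaussianReal, ← h i, charFun_apply_real,
      integral_map (hf i).aemeasurable (by fun_prop)]
  rw [charFun_apply_real, integral_map hm.aemeasurable (by fun_prop), charFun_gaussianReal]
  have : ∀ x : ∀ i, α i, Complex.exp (t * ((∑ i, f i (x i) : ℝ) : ℂ) * Complex.I) =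
      ∏ i, Complex.exp (t * f i (x i) * Complex.I) := fun x => by
    rw [← Complex.exp_sum]
    push_cast
    rw [Finset.mul_sum, Finset.sum_mul]
  simp_rw [this]
  rw [integral_fintype_prod_eq_prod (fun i x => Complex.exp (t * f i x * Complex.I))]
  simp_rw [hi]
  rw [← Complex.exp_sum]
  congr 1
  push_cast
  simp only [Finset.sum_sub_distrib, Finset.mul_sum, Finset.sum_mul, Finset.sum_div]

/-- The Neyman-Pearson inequality for the sublevel sets of a density. -/
lemma neymanPearson {α : Type*} [MeasurableSpace α] (μ : Measure α) [IsProbabilityMeasure μ]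
    (L : α → ℝ) (hL : Measurable L)
    [IsProbabilityMeasure (μ.withDensity fun x => ENNReal.ofReal (L x))] (t : ℝ) (ht : 0 ≤ t)
    (H : Set α) (hH : MeasurableSet H) :
    (μ.withDensity fun x => ENNReal.ofReal (L x)).real {x | L x ≤ t} +
        t * (μ.real H - μ.real {x | L x ≤ t}) ≤
      (μ.withDensity fun x => ENNReal.ofReal (L x)).real H := by
  set ν := μ.withDensity fun x => ENNReal.ofReal (L x)
  set U := {x | L x ≤ t}
  have hU : MeasurableSet U := measurableSet_le hL measurable_const
  -- `H` and `U` differ only on `H \ U`, where `L > t`, and on `U \ H`, where `L ≤ t`; the common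
  -- part cancels.
  have h1 : t * μ.real (H \ U) ≤ ν.real (H \ U) := by
    have : ENNReal.ofReal t * μ (H \ U) ≤ ν (H \ U) := by
      rw [withDensity_apply _ (hH.diff hU), ← setLIntegral_const]
      refine setLIntegral_mono' (hH.diff hU) fun x hx => ENNReal.ofReal_le_ofReal ?_
      exact (not_le.1 hx.2).le
    have := ENNReal.toReal_mono (measure_ne_top _ _) this
    rwa [ENNReal.toReal_mul, ENNReal.toReal_ofReal ht] at this
  have h2 : ν.real (U \ H) ≤ t * μ.real (U \ H) := by
    have : ν (U \ H) ≤ ENNReal.ofReal t * μ (U \ H) := by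
      rw [withDensity_apply _ (hU.diff hH), ← setLIntegral_const]
      exact setLIntegral_mono' (hU.diff hH) fun x hx => ENNReal.ofReal_le_ofReal hx.1
    have := ENNReal.toReal_mono (by finiteness) this
    rwa [ENNReal.toReal_mul, ENNReal.toReal_ofReal ht] at this
  have e1 := measureReal_sdiff_add_inter (μ := μ) (s := H) hU
  have e2 := measureReal_sdiff_add_inter (μ := ν) (s := H) hU
  have e3 := measureReal_sdiff_add_inter (μ := μ) (s := U) hH
  have e4 := measureReal_sdiff_add_inter (μ := ν) (s := U) hH
  rw [Set.inter_comm] at e3 e4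
  rw [← e1, ← e2, ← e3, ← e4]
  linarith

lemma gaussianReal_add_eq_withDensity (m d : ℝ) {v : NNReal} (hv : v ≠ 0) :
    gaussianReal (m + d) v = (gaussianReal m v).withDensity
      (fun x => ENNReal.ofReal (Real.exp ((d * (x - m) - d ^ 2 / 2) / v))) := by
  have hv' : (v : ℝ) ≠ 0 := by exact_mod_cast hv
  rw [gaussianReal_of_var_ne_zero _ hv, gaussianReal_of_var_ne_zero _ hv,
    ← withDensity_mul _ (measurable_gaussianPDF _ _) (by fun_prop)]
  congr 1
  funext x
  rw [Pi.mul_apply, gaussianPDF, gaussianPDF, ← ENNReal.ofReal_mul (gaussianPDFReal_nonneg _ _ _),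
    gaussianPDFReal, gaussianPDFReal, mul_assoc (√(2 * Real.pi * v))⁻¹, ← Real.exp_add]
  congr 3
  field_simp
  ring

/-- The distribution function of a Gaussian measure in terms of the standard one. -/
lemma gaussianReal_real_Iic (m s : ℝ) {k : ℝ} (hk : 0 < k) :
    (gaussianReal m (k ^ 2).toNNReal).real (Set.Iic (m + k * s)) = cdf (gaussianReal 0 1) s := by
  have h1 : gaussianReal m (k ^ 2).toNNReal =
      ((gaussianReal 0 1).map (k * ·)).map (m + ·) := by
    rw [gaussianReal_map_const_mul, gaussianReal_map_const_add]
    congr 1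
    · ring
    · ext; simp [sq_nonneg]
  rw [h1, Measure.map_map (by fun_prop) (by fun_prop), cdf_eq_real,
    map_measureReal_apply (by fun_prop) measurableSet_Iic]
  congr 1
  ext x
  simp [hk]

lemma strictMono_cdf_gaussianReal : StrictMono (cdf (gaussianReal 0 1)) := by
  intro a b hab
  have h : (gaussianReal 0 1) (Set.Ioc a b) ≠ 0 := by
    intro h0
    -- Lebesgue measure is absolutely continuous with respect to the Gaussian, so a null interval
    -- would have length zero.
    have := gaussianReal_absolutelyContinuous' 0 (v := 1) one_ne_zero h0
    simp [hab.not_ge] at this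
  rw [← measure_cdf (gaussianReal 0 1), StieltjesFunction.measure_Ioc] at h
  simpa using h

end HierarchicalSmoothing

noncomputable section

namespace HierarchicalSmoothing

/-! ### The law of the matrix given the indicator -/

/-- The law of a single noisy row with clean value `x` and selection bit `b`. -/
def rowNoise {D : ℕ} (σ : ℝ) (x : Fin D → ℝ) (b : Bool) : Measure (Fin D → ℝ) :=
  if b = true then Measure.pi fun j => gaussianReal (x j) (σ ^ 2).toNNReal else Measure.dirac x

instance {D : ℕ} (σ : ℝ) (x : Fin D → ℝ) (b : Bool) : IsProbabilityMeasure (rowNoise σ x b) := by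
  unfold rowNoise; split <;> infer_instance

lemma lower_eq_pi {N D : ℕ} (σ : ℝ) (X : Mat N D) (τ : Fin N → Bool) :
    lower σ X τ = Measure.pi fun i => rowNoise σ (X i) (τ i) := rfl

instance {N D : ℕ} (σ : ℝ) (X : Mat N D) (τ : Fin N → Bool) :
    IsProbabilityMeasure (lower σ X τ) := by
  rw [lower_eq_pi]; infer_instance

/-- Dirac masses at distinct points are mutually singular, so an unselected row must be unchanged;
its density is then 1. -/
lemma rowNoise_eq_withDensity {D : ℕ} {σ : ℝ} (hσ : 0 < σ) (x x' : Fin D → ℝ) (b : Bool)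
    (hb : b = true ∨ x' = x) :
    rowNoise σ x' b = (rowNoise σ x b).withDensity (fun w => ENNReal.ofReal (Real.exp
      ((∑ j, (x' j - x j) * (w j - x j) - (∑ j, (x' j - x j) ^ 2) / 2) / σ ^ 2))) := by
  by_cases h : x' = x
  · subst h
    simp only [sub_self, zero_mul, Finset.sum_const_zero, ne_eq, OfNat.ofNat_ne_zero,
      not_false_eq_true, zero_pow, zero_div, Real.exp_zero, ENNReal.ofReal_one]
    exact withDensity_one.symm
  have hb' : b = true := hb.resolve_right h
  have hv : (σ ^ 2).toNNReal ≠ 0 := by simp [hσ.ne']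
  have hs (j : Fin D) := gaussianReal_add_eq_withDensity (x j) (x' j - x j) hv
  simp only [add_sub_cancel, Real.coe_toNNReal _ (sq_nonneg σ)] at hs
  have : ∀ j, IsProbabilityMeasure ((gaussianReal (x j) (σ ^ 2).toNNReal).withDensity
      (fun w => ENNReal.ofReal (Real.exp
        (((x' j - x j) * (w - x j) - (x' j - x j) ^ 2 / 2) / σ ^ 2)))) := fun j => by
    rw [← hs j]; infer_instance
  simp only [rowNoise, hb', if_true]
  simp_rw [hs]
  rw [pi_withDensity _ _ fun j => by fun_prop]
  congr 1
  funext w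
  rw [← ENNReal.ofReal_prod_of_nonneg fun _ _ => (Real.exp_pos _).le, ← Real.exp_sum,
    ← Finset.sum_div, Finset.sum_sub_distrib, ← Finset.sum_div]

lemma lower_eq_withDensity {N D : ℕ} {σ : ℝ} (hσ : 0 < σ) (X X' : Mat N D) (τ : Fin N → Bool)
    (hτ : ∀ i, X i ≠ X' i → τ i = true) :
    lower σ X' τ = (lower σ X τ).withDensity (fun W => ENNReal.ofReal (Real.exp
      ((∑ i, ∑ j, (X' i j - X i j) * (W i j - X i j) -
        (∑ i, ∑ j, (X' i j - X i j) ^ 2) / 2) / σ ^ 2))) := by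
  have hs (i : Fin N) := rowNoise_eq_withDensity hσ (X i) (X' i) (τ i)
    (or_iff_not_imp_right.2 fun h => hτ i (Ne.symm h))
  have : ∀ i, IsProbabilityMeasure ((rowNoise σ (X i) (τ i)).withDensity
      (fun w => ENNReal.ofReal (Real.exp
        ((∑ j, (X' i j - X i j) * (w j - X i j) - (∑ j, (X' i j - X i j) ^ 2) / 2) / σ ^ 2)))) :=
    fun i => by rw [← hs i]; infer_instance
  rw [lower_eq_pi, lower_eq_pi]
  simp_rw [hs]
  rw [pi_withDensity _ _ fun i => by fun_prop]
  congr 1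
  funext w
  rw [← ENNReal.ofReal_prod_of_nonneg fun _ _ => (Real.exp_pos _).le, ← Real.exp_sum,
    ← Finset.sum_div, Finset.sum_sub_distrib, ← Finset.sum_div]

lemma map_rowNoise {D : ℕ} (σ : ℝ) (x c d : Fin D → ℝ) (b : Bool) (hb : b = true ∨ d = 0) :
    (rowNoise σ x b).map (fun w => ∑ j, d j * (w j - c j)) =
      gaussianReal (∑ j, d j * (x j - c j)) ((∑ j, d j ^ 2) * σ ^ 2).toNNReal := by
  by_cases h : d = 0
  · simp [h, gaussianReal_zero_var]
  simp only [rowNoise, hb.resolve_right h, if_true]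
  rw [map_sum_pi_gaussianReal _ (fun j y => d j * (y - c j)) (fun j => by fun_prop)
    (fun j => d j * (x j - c j)) (fun j => (d j ^ 2).toNNReal * (σ ^ 2).toNNReal)]
  · congr 1
    rw [← Finset.sum_mul, Real.toNNReal_mul (Finset.sum_nonneg fun _ _ => sq_nonneg _),
      Real.toNNReal_sum_of_nonneg fun _ _ => sq_nonneg _]
  · intro j
    rw [show (fun y => d j * (y - c j)) = (fun y => d j * y) ∘ (fun y => y - c j) from rfl,
      ← Measure.map_map (by fun_prop) (by fun_prop), gaussianReal_map_sub_const,
      gaussianReal_map_const_mul]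
    congr 2
    ext
    simp [sq_nonneg]

/-- The centre `c` is kept apart from the mean so that one functional can be evaluated under both
laws. Unselected rows have `d i = 0` and contribute nothing. -/
lemma map_lower {N D : ℕ} (σ : ℝ) (X c d : Mat N D) (τ : Fin N → Bool)
    (hτ : ∀ i, d i ≠ 0 → τ i = true) :
    (lower σ X τ).map (fun W => ∑ i, ∑ j, d i j * (W i j - c i j)) =
      gaussianReal (∑ i, ∑ j, d i j * (X i j - c i j))
        ((∑ i, ∑ j, d i j ^ 2) * σ ^ 2).toNNReal := by
  have h := map_sum_pi_gaussianReal (fun i => rowNoise σ (X i) (τ i))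
    (fun i w => ∑ j, d i j * (w j - c i j)) (fun i => by fun_prop) _ _
    fun i => map_rowNoise σ (X i) (c i) (d i) (τ i) (or_iff_not_imp_right.2 (hτ i))
  rw [lower_eq_pi, h, Finset.sum_mul, Real.toNNReal_sum_of_nonneg]
  exact fun i _ => mul_nonneg (Finset.sum_nonneg fun _ _ => sq_nonneg _) (sq_nonneg _)

/-- If all changed rows are selected, the conditional probability of an event at the perturbed
input is bounded below by an affine function of its probability at the clean input; the slope
does not depend on the indicator. -/
lemma exists_lower_bound {N D : ℕ} {σ : ℝ} (hσ : 0 < σ) (X X' : Mat N D) (s : ℝ) :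
    ∃ t : ℝ, 0 ≤ t ∧ ∀ τ : Fin N → Bool, (∀ i, X i ≠ X' i → τ i = true) →
      ∀ H : Set (Mat N D), MeasurableSet H →
        cdf (gaussianReal 0 1) (s - √(∑ i, ∑ j, (X' i j - X i j) ^ 2) / σ) +
            t * ((lower σ X τ).real H - cdf (gaussianReal 0 1) s) ≤ (lower σ X' τ).real H := by
  -- The functional degenerates here; slope 1 gives equality.
  by_cases hX : X' = X
  · subst hX
    exact ⟨1, zero_le_one, fun τ _ H _ => by simp⟩
  set Q := ∑ i, ∑ j, (X' i j - X i j) ^ 2 with hQ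
  have hQ0 : 0 < Q := by
    obtain ⟨i, hi⟩ := Function.ne_iff.1 hX
    obtain ⟨j, hj⟩ := Function.ne_iff.1 hi
    refine Finset.sum_pos' (fun i _ => Finset.sum_nonneg fun j _ => sq_nonneg _)
      ⟨i, Finset.mem_univ i, Finset.sum_pos' (fun j _ => sq_nonneg _) ⟨j, Finset.mem_univ j, ?_⟩⟩
    exact sq_pos_of_ne_zero (sub_ne_zero.2 hj)
  -- The standard deviation of `ℓ` below, at both inputs.
  set k := √Q * σ with hk
  have hk0 : 0 < k := mul_pos (Real.sqrt_pos.2 hQ0) hσ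
  have hk2 : k ^ 2 = Q * σ ^ 2 := by rw [hk, mul_pow, Real.sq_sqrt hQ0.le]
  -- The slope is the likelihood ratio on `ℓ = k * s`, which makes the Neyman-Pearson region the
  -- half-space `ℓ ≤ k * s`.
  refine ⟨Real.exp ((k * s - Q / 2) / σ ^ 2), (Real.exp_pos _).le, fun τ hτ H hH => ?_⟩
  have hd := lower_eq_withDensity hσ X X' τ hτ
  set ℓ : Mat N D → ℝ := fun W => ∑ i, ∑ j, (X' i j - X i j) * (W i j - X i j) with hℓ
  have hℓm : Measurable ℓ := by fun_prop
  have hτ' : ∀ i, (X' - X) i ≠ 0 → τ i = true := fun i h =>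
    hτ i fun e => h (by simp [e])
  have hU : {W | Real.exp ((ℓ W - Q / 2) / σ ^ 2) ≤ Real.exp ((k * s - Q / 2) / σ ^ 2)} =
      ℓ ⁻¹' Set.Iic (k * s) := by
    ext W
    simp only [Set.mem_ofPred_eq, Real.exp_le_exp, Set.mem_preimage, Set.mem_Iic]
    rw [div_le_div_iff_of_pos_right (by positivity), sub_le_sub_iff_right]
  have h1 : (lower σ X τ).real (ℓ ⁻¹' Set.Iic (k * s)) = cdf (gaussianReal 0 1) s := by
    rw [← map_measureReal_apply hℓm measurableSet_Iic]
    have := map_lower σ X X (X' - X) τ hτ'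
    simp only [Pi.sub_apply, sub_self, mul_zero, Finset.sum_const_zero] at this
    rw [this, ← hQ, ← hk2]
    simpa using gaussianReal_real_Iic 0 s hk0
  have h2 : (lower σ X' τ).real (ℓ ⁻¹' Set.Iic (k * s)) =
      cdf (gaussianReal 0 1) (s - √Q / σ) := by
    rw [← map_measureReal_apply hℓm measurableSet_Iic]
    have := map_lower σ X' X (X' - X) τ hτ'
    simp only [Pi.sub_apply, ← pow_two] at this
    rw [hℓ, this, ← hQ, ← hk2, ← gaussianReal_real_Iic Q _ hk0]
    -- The mean of `ℓ` moves from 0 to `Q`, which is `√Q / σ` standard deviations.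
    congr 2
    rw [hk]
    field_simp
    linarith [Real.mul_self_sqrt hQ0.le]
  have : IsProbabilityMeasure ((lower σ X τ).withDensity
      (fun W => ENNReal.ofReal (Real.exp ((ℓ W - Q / 2) / σ ^ 2)))) := by
    rw [← hd]; infer_instance
  have h3 := neymanPearson (lower σ X τ) (fun W => Real.exp ((ℓ W - Q / 2) / σ ^ 2))
    (by fun_prop) _ (Real.exp_pos ((k * s - Q / 2) / σ ^ 2)).le H hH
  rwa [hU, ← hd, h1, h2] at h3

/-! ### Averaging over the indicator -/

instance (N : ℕ) (p : unitInterval) : IsProbabilityMeasure (upper N p) := by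
  unfold upper; infer_instance

/-- The probability that all rows of `K` are selected. -/
lemma upper_real_selected {N : ℕ} (p : unitInterval) (K : Finset (Fin N)) :
    (upper N p).real {τ | ∀ i ∈ K, τ i = true} = (p : ℝ) ^ K.card := by
  classical
  have h : {τ : Fin N → Bool | ∀ i ∈ K, τ i = true} =
      Set.univ.pi fun i => if i ∈ K then {true} else Set.univ := by
    ext τ
    simp only [Set.mem_ofPred_eq, Set.mem_pi, Set.mem_univ, true_implies]
    refine forall_congr' fun i => ?_
    by_cases hi : i ∈ K <;> simp [hi]
  rw [h, upper, measureReal_def, Measure.pi_pi, ENNReal.toReal_prod]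
  have : ∀ i, (bernoulliMeasure true false p (if i ∈ K then {true} else Set.univ)).toReal =
      if i ∈ K then (p : ℝ) else 1 := fun i => by
    rw [← measureReal_def]
    by_cases hi : i ∈ K <;> simp [hi]
  simp_rw [this]
  rw [Finset.prod_ite_mem, Finset.univ_inter, Finset.prod_const]

lemma hier_real_eq_sum {N D : ℕ} (p : unitInterval) (σ : ℝ) (X : Mat N D) {E : Set (Ext N D)}
    (hE : MeasurableSet E) :
    (hier p σ X).real E = ∑ τ : Fin N → Bool,
      (upper N p).real {τ} * (lower σ X τ).real ((fun W => (W, τ)) ⁻¹' E) := by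
  rw [hier, measureReal_def, Measure.finsetSum_apply, ENNReal.toReal_sum]
  · refine Finset.sum_congr rfl fun τ _ => ?_
    rw [Measure.smul_apply, smul_eq_mul, ENNReal.toReal_mul,
      Measure.map_apply (by fun_prop) hE]
    rfl
  · intro τ _
    rw [Measure.smul_apply, smul_eq_mul, Measure.map_apply (by fun_prop) hE]
    finiteness

lemma sum_upper_real_singleton {N : ℕ} (p : unitInterval) (s : Finset (Fin N → Bool)) :
    ∑ τ ∈ s, (upper N p).real {τ} = (upper N p).real s := by
  simp

instance {N D : ℕ} (p : unitInterval) (σ : ℝ) (X : Mat N D) :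
    IsProbabilityMeasure (hier p σ X) := by
  have h : (hier p σ X).real Set.univ = 1 := by
    rw [hier_real_eq_sum p σ X MeasurableSet.univ]
    simp
  exact ⟨by simpa [measureReal_def, ENNReal.toReal_eq_one_iff] using h⟩

/-- The certificate for a single event and a single perturbed input. -/
lemma hier_real_lower_bound {N D : ℕ} {p : unitInterval} {r : ℕ} {ε σ : ℝ} (hσ : 0 < σ)
    {X X' : Mat N D} (hX' : X' ∈ threatModel r ε X) {E : Set (Ext N D)} (hE : MeasurableSet E)
    {s : ℝ} (hs : cdf (gaussianReal 0 1) s < ((hier p σ X).real E - (1 - (p : ℝ) ^ r)) / p ^ r) :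
    (p : ℝ) ^ r * cdf (gaussianReal 0 1) (s - ε / σ) ≤ (hier p σ X').real E := by
  classical
  obtain ⟨hcard, hnorm⟩ := hX'
  have hp0 : (0 : ℝ) ≤ p := p.2.1
  have hpr : 0 < (p : ℝ) ^ r := by
    -- Division by `p ^ r = 0` would return 0 and force a negative value of the distribution
    -- function.
    refine (pow_nonneg hp0 r).lt_of_ne fun h => ?_
    rw [← h, div_zero] at hs
    exact hs.not_ge (cdf_nonneg _ _)
  rw [lt_div_iff₀ hpr] at hs
  set K : Finset (Fin N) := Finset.univ.filter fun i => X i ≠ X' i with hK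
  have hKr : K.card ≤ r := by
    rwa [← Set.ncard_coe_finset, hK, Finset.coe_filter_univ]
  have hpk : (p : ℝ) ^ r ≤ (p : ℝ) ^ K.card := pow_le_pow_of_le_one hp0 p.2.2 hKr
  set A : Finset (Fin N → Bool) := Finset.univ.filter fun τ => ∀ i ∈ K, τ i = true with hA
  have hAw : ∑ τ ∈ A, (upper N p).real {τ} = (p : ℝ) ^ K.card := by
    rw [sum_upper_real_singleton, hA, Finset.coe_filter_univ, upper_real_selected]
  have hAc : ∑ τ ∈ Finset.univ \ A, (upper N p).real {τ} = 1 - (p : ℝ) ^ K.card := by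
    rw [eq_sub_iff_add_eq, ← hAw, Finset.sum_sdiff (Finset.subset_univ A),
      sum_upper_real_singleton]
    simp
  set P : (Fin N → Bool) → ℝ := fun τ => (lower σ X τ).real ((fun W => (W, τ)) ⁻¹' E)
  have hPX : (hier p σ X).real E ≤
      ∑ τ ∈ A, (upper N p).real {τ} * P τ + (1 - (p : ℝ) ^ K.card) := by
    rw [hier_real_eq_sum p σ X hE, ← Finset.sum_sdiff (Finset.subset_univ A), add_comm, ← hAc]
    gcongr with τ hτ
    exact mul_le_of_le_one_right measureReal_nonneg measureReal_le_one
  obtain ⟨t, ht, hbound⟩ := exists_lower_bound hσ X X' s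
  set d := √(∑ i, ∑ j, (X' i j - X i j) ^ 2) with hd
  have hdε : d ≤ ε := by
    rw [EuclideanSpace.norm_eq, Fintype.sum_prod_type] at hnorm
    refine le_of_eq_of_le ?_ hnorm
    rw [hd]
    congr 1
    refine Finset.sum_congr rfl fun i _ => Finset.sum_congr rfl fun j _ => ?_
    rw [Real.norm_eq_abs, sq_abs]
    ring
  set Φ := cdf (gaussianReal 0 1)
  have hPX' : (p : ℝ) ^ K.card * Φ (s - d / σ) +
      t * (∑ τ ∈ A, (upper N p).real {τ} * P τ - (p : ℝ) ^ K.card * Φ s) ≤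
        (hier p σ X').real E := by
    rw [hier_real_eq_sum p σ X' hE, ← hAw, Finset.sum_mul, Finset.sum_mul,
      ← Finset.sum_sub_distrib, Finset.mul_sum, ← Finset.sum_add_distrib]
    refine (Finset.sum_le_sum fun τ hτ => ?_).trans (Finset.sum_le_sum_of_subset_of_nonneg
      (Finset.subset_univ A) fun τ _ _ => mul_nonneg measureReal_nonneg measureReal_nonneg)
    have := hbound τ (fun i hi => (Finset.mem_filter.1 hτ).2 i (by simpa [hK] using hi))
      ((fun W => (W, τ)) ⁻¹' E) (hE.preimage (by fun_prop))
    refine le_trans (le_of_eq ?_) (mul_le_mul_of_nonneg_left this measureReal_nonneg)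
    ring
  have hgap : 0 ≤ ∑ τ ∈ A, (upper N p).real {τ} * P τ - (p : ℝ) ^ K.card * Φ s := by
    -- By `hPX` and `hs` the difference is at least `(p ^ K.card - p ^ r) * (1 - Φ s)`.
    nlinarith [mul_nonneg (sub_nonneg.2 hpk) (sub_nonneg.2 (cdf_le_one (gaussianReal 0 1) s))]
  calc (p : ℝ) ^ r * Φ (s - ε / σ) ≤ (p : ℝ) ^ K.card * Φ (s - d / σ) := by
        gcongr
        exact cdf_nonneg _ _
    _ ≤ _ := (le_add_of_nonneg_right (mul_nonneg ht hgap)).trans hPX'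

/-! ### From quantiles to the certificate -/

/-- The strict inequality leaves room for real points `s` and `x`, so infinite quantiles need no
further treatment. In `EReal` both `⊤ - ⊤` and `⊥ - ⊥` are `⊥`, which the hypothesis excludes. -/
lemma exists_of_lt_quantile_sub {a b ε σ : ℝ} (hσ : 0 < σ)
    (h : (ε : EReal) < (σ : EReal) * (quantile a - quantile b)) :
    ∃ s x : ℝ, cdf (gaussianReal 0 1) s < a ∧ b ≤ cdf (gaussianReal 0 1) x ∧ x + ε / σ < s := by
  have hbot : quantile a - quantile b ≠ ⊥ := fun h0 => by
    rw [h0, EReal.coe_mul_bot_of_pos hσ] at h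
    exact not_lt_bot h
  have hs : ∀ s : ℝ, (s : EReal) < quantile a → cdf (gaussianReal 0 1) s < a := fun s hs => by
    by_contra! hc
    exact hs.not_ge (sInf_le ⟨s, hc, rfl⟩)
  have hx : ∀ y : ℝ, quantile b < y → ∃ x : ℝ, b ≤ cdf (gaussianReal 0 1) x ∧ x < y :=
    fun y hy => by
      obtain ⟨_, ⟨x, hx, rfl⟩, hxy⟩ := sInf_lt_iff.1 hy
      exact ⟨x, hx, EReal.coe_lt_coe_iff.1 hxy⟩
  have ha : quantile a ≠ ⊥ := fun h0 => hbot (by simp [h0])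
  have hb : quantile b ≠ ⊤ := fun h0 => hbot (by simp [h0])
  obtain ⟨s, y, h1, h2, h3⟩ : ∃ s y : ℝ, (s : EReal) < quantile a ∧ quantile b < y ∧
      y + ε / σ < s := by
    induction hqa : quantile a with
    | bot => exact absurd hqa ha
    | top =>
      obtain ⟨y, hy, -⟩ := EReal.lt_iff_exists_real_btwn.1 (lt_top_iff_ne_top.2 hb)
      exact ⟨y + ε / σ + 1, y, EReal.coe_lt_top _, hy, by linarith⟩
    | coe qa =>
      obtain ⟨s, -, hs'⟩ := EReal.lt_iff_exists_real_btwn.1 (bot_lt_iff_ne_bot.2 ha)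
      rw [hqa] at hs'
      induction hqb : quantile b with
      | top => exact absurd hqb hb
      | bot => exact ⟨s, s - ε / σ - 1, hs', EReal.bot_lt_coe _, by linarith⟩
      | coe qb =>
        rw [hqa, hqb, ← EReal.coe_sub, ← EReal.coe_mul, EReal.coe_lt_coe_iff, mul_comm,
          ← div_lt_iff₀ hσ] at h
        -- One third of the slack is spent at each end; the last third keeps the inequality strict.
        refine ⟨qa - (qa - qb - ε / σ) / 3, qb + (qa - qb - ε / σ) / 3, ?_, ?_, ?_⟩
        · rw [EReal.coe_lt_coe_iff]; linarith
        · rw [EReal.coe_lt_coe_iff]; linarith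
        · linarith
  obtain ⟨x, hx1, hx2⟩ := hx y h2
  exact ⟨s, x, hs s h1, hx1, by linarith⟩

lemma self_mem_threatModel {N D : ℕ} (r : ℕ) {ε : ℝ} (hε : 0 ≤ ε) (X : Mat N D) :
    X ∈ threatModel r ε X := by
  refine ⟨by simp, ?_⟩
  simp only [sub_self]
  exact (norm_eq_zero.2 rfl).trans_le hε

/-- Two different labels cannot both have probability larger than one half. -/
lemma eq_of_half_lt_labelProb {N D C : ℕ} {p : unitInterval} {σ : ℝ} {f : Ext N D → Fin C}
    (hf : Measurable f) {X : Mat N D} {y z : Fin C} (hy : 1 / 2 < labelProb p σ f X y)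
    (hz : 1 / 2 < labelProb p σ f X z) : y = z := by
  by_contra hne
  have hd : Disjoint {w | f w = y} {w | f w = z} :=
    Set.disjoint_left.2 fun w h1 h2 => hne (h1.symm.trans h2)
  have h := measureReal_union (μ := hier p σ X) hd (hf (measurableSet_singleton z))
  have h1 : (hier p σ X).real ({w | f w = y} ∪ {w | f w = z}) ≤ 1 := measureReal_le_one
  unfold labelProb at hy hz
  linarith

/-- The certificate over the whole ball of perturbations. -/
theorem certified_robustness {N D C : ℕ} (r : ℕ) (ε σ : ℝ) (hε : 0 ≤ ε) (hσ : 0 < σ) (p : unitInterval)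
    (f : Ext N D → Fin C) (hf : Measurable f)
    (g : Mat N D → Fin C) (hg : IsSmoothed p σ f g)
    (X : Mat N D)
    (Δ : ℝ) (hΔ : Δ = 1 - (p : ℝ) ^ r)
    (hcert : (ε : EReal) < (σ : EReal) *
      (quantile
          ((labelProb p σ f X (g X) - Δ) / (1 - Δ))
        - quantile (1 / (2 * (1 - Δ))))) :
    1 / 2 < (⨅ X' : threatModel r ε X,
        worstCase C p σ X (X' : Mat N D) (g X)
          (labelProb p σ f X (g X))) ∧
      ∀ X' ∈ threatModel r ε X, g X' = g X := by
  subst hΔ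
  rw [sub_sub_cancel] at hcert
  obtain ⟨s, x, hs, hx, hsx⟩ := exists_of_lt_quantile_sub hσ hcert
  have hpr : 0 < (p : ℝ) ^ r := by
    refine (pow_nonneg p.2.1 r).lt_of_ne fun h => ?_
    rw [← h, div_zero] at hs
    exact hs.not_ge (cdf_nonneg _ _)
  have hB : 1 / 2 < (p : ℝ) ^ r * cdf (gaussianReal 0 1) (s - ε / σ) := by
    have := hx.trans_lt (strictMono_cdf_gaussianReal (lt_sub_iff_add_lt.2 hsx))
    rw [div_lt_iff₀ (by positivity)] at this
    linarith
  have hbound : ∀ X' ∈ threatModel r ε X, ∀ h : Ext N D → Fin C, Measurable h →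
      labelProb p σ h X (g X) = labelProb p σ f X (g X) →
      (p : ℝ) ^ r * cdf (gaussianReal 0 1) (s - ε / σ) ≤ labelProb p σ h X' (g X) :=
    fun X' hX' h hh hq =>
      hier_real_lower_bound hσ hX' (hh (measurableSet_singleton (g X))) (hs.trans_eq (by rw [← hq]; rfl))
  refine ⟨hB.trans_le ?_, fun X' hX' => ?_⟩
  -- Real infima are bounded below termwise only over nonempty families: `X` lies in the ball and
  -- `f` is admissible.
  · have : Nonempty (threatModel r ε X) := ⟨X, self_mem_threatModel r hε X⟩
    refine le_ciInf fun X' => le_csInf ⟨_, f, hf, rfl, rfl⟩ ?_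
    rintro _ ⟨h, hh, hq, rfl⟩
    exact hbound X' X'.2 h hh hq
  · have hlt := hB.trans_le (hbound X' hX' f hf rfl)
    exact eq_of_half_lt_labelProb hf (hlt.trans_le (hg X' (g X))) hlt

end HierarchicalSmoothing

end

/-- `hcert` does fail for `Δ ≥ 1/2`: if `Δ < 1` the subtracted quantile is `⊤`; if `Δ = 1`, division
by zero makes both quantiles `⊥`. Either way the difference is `⊥`. -/
theorem corollary1 {N D C : ℕ} (r : ℕ) (ε σ : ℝ) (hε : 0 ≤ ε) (hσ : 0 < σ) (p : unitInterval)
    (f : HierarchicalSmoothing.Ext N D → Fin C) (hf : Measurable f)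
    (g : HierarchicalSmoothing.Mat N D → Fin C) (hg : HierarchicalSmoothing.IsSmoothed p σ f g)
    (X : HierarchicalSmoothing.Mat N D)
    (Δ : ℝ) (hΔ : Δ = 1 - (p : ℝ) ^ r)
    (hcert : (ε : EReal) < (σ : EReal) *
      (HierarchicalSmoothing.quantile
          ((HierarchicalSmoothing.labelProb p σ f X (g X) - Δ) / (1 - Δ))
        - HierarchicalSmoothing.quantile (1 / (2 * (1 - Δ))))) :
    1 / 2 < (⨅ X' : HierarchicalSmoothing.threatModel r ε X,
        HierarchicalSmoothing.worstCase C p σ X (X' : HierarchicalSmoothing.Mat N D) (g X)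
          (HierarchicalSmoothing.labelProb p σ f X (g X))) ∧
      ∀ X' ∈ HierarchicalSmoothing.threatModel r ε X, g X' = g X := by
  exact HierarchicalSmoothing.certified_robustness r ε σ hε hσ p f hf g hg X Δ hΔ hcert
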